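/- Let $S^m$ be the Euclidean space of real symmetric $m\times m$ matrices with $\langle Y,D\rangle=\operatorname{tr}(YD)$, let $S^m_+$ be the cone of positive-semidefinite matrices, $\delta_{S^m_+}$ its indicator function ($0$ on $S^m_+$, $+\infty$ elsewhere), and $\Pi_{S^m_+}=\operatorname{Prox}_{\delta_{S^m_+}}$ the metric projection onto it. For a Lipschitz map $S$ of a Euclidean space into itself, the limiting Jacobian $\overline\nabla S(x)$ is the set of all limits of derivatives $S'(x^k)$ along sequences $x^k\to x$ of points at which $S$ is differentiable, and $JS(x)$ is the convex hull of $\overline\nabla S(x)$. We say that a function $r:E\to(-\infty,\infty]$ on a Euclidean space $E$ satisfies Assumption 2 at $\bar x$ for $\bar u$ if $r$ is lower semicontinuous, proper and convex, $\bar x\in\operatorname{dom}r$, $\bar u\in\partial r(\bar x)$ (limiting subdifferential), and there is $\overline W\in\overline\nabla\operatorname{Prox}_r(\bar x+\bar u)$ such that $$\bigcup_{W\in J\operatorname{Prox}_r(\bar x+\bar u)}\operatorname{rge}W=\operatorname{rge}\overline W,$$ and such that for every $y$ in this union there is $\bar z$ with $y=\overline W\bar z$ and $$\langle y,\bar z-y\rangle=\min\{\langle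 y,z-y\rangle : z\in E,\ W\in J\operatorname{Prox}_r(\bar x+\bar u),\ y=Wz\}.$$ Let $X\in S^m_+$ and $U\in\mathcal N_{S^m_+}(X)$ (limiting normal cone). Then $\delta_{S^m_+}$ satisfies Assumption 2 at $X$ for $U$. Moreover, let $X+U=P\Lambda P^T$ with $P$ orthogonal and $\Lambda=\operatorname{Diag}(\sigma_1,\dots,\sigma_m)$, and put $\alpha=\{i:\sigma_i>0\}$, $\beta=\{i:\sigma_i=0\}$, $\gamma=\{i:\sigma_i<0\}$, $\widetilde D=P^TDP$ for $D\in S^m$, and $$\Sigma_{ij}=\frac{\max\{\sigma_i,0\}+\max\{\sigma_j,0\}}{|\sigma_i|+|\sigma_j|}\quad(0/0:=1).$$ Then the following hold. (a) The identity map of $S^{|\beta|}$ belongs to $\overline\nabla\Pi_{S^{|\beta|}_+}(0)$, and there is $\overline W\in\overline\nabla\Pi_{S^m_+}(X+U)$ given, for all $D\in S^m$, by $$\overline WD=P\begin{pmatrix}\widetilde D_{\alpha\alpha}&\widetilde D_{\alpha\beta}&\Sigma_{\alpha\gamma}\circ\widetilde D_{\alpha\gamma}\\ \widetilde D_{\beta\alpha}&\widetilde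 D_{\beta\beta}&0\\ \Sigma_{\gamma\alpha}\circ\widetilde D_{\gamma\alpha}&0&0\end{pmatrix}P^T,$$ where $\circ$ is the entrywise product. (b) For this $\overline W$, the union $\bigcup_{W\in J\Pi_{S^m_+}(X+U)}\operatorname{rge}W$ is equal to $\operatorname{rge}\overline W$, that is, to the set of all matrices of the form displayed in (a) with $D\in S^m$. (c) For every $Y$ in this union, with $\widetilde Y=P^TYP$, there is $\overline D\in S^m$ with $Y=\overline W\,\overline D$ such that $P^T\overline DP=(d_{ij})$ satisfies $$d_{ij}=\widetilde Y_{ij}\ \ (i,j\in\alpha\cup\beta),\qquad d_{ij}=d_{ji}=\frac{\sigma_i-\sigma_j}{\sigma_i}\widetilde Y_{ij}\ \ (i\in\alpha,\ j\in\gamma),$$ and $$\langle Y,\overline D-Y\rangle=\min\{\langle Y,D-Y\rangle : D\in S^m,\ W\in J\Pi_{S^m_+}(X+U),\ Y=WD\}=-2\sum_{i\in\alpha,\,j\in\gamma}\frac{\sigma_j}{\sigma_i}\widetilde Y_{ij}^2 .$$ -/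

import Mathlib

open scoped Topology Matrix

noncomputable section

/-! ### Extended-real-valued functions and proximal mappings -/

section VariationalAnalysis

variable {E : Type*} [NormedAddCommGroup E] [InnerProductSpace ℝ E]

/-- The effective domain `dom r`. -/
def effDomain (r : E → EReal) : Set E := {x | r x < ⊤}

/-- The epigraph of `r`, a subset of `E × ℝ`. -/
def epigraph (r : E → EReal) : Set (E × ℝ) := {p | r p.1 ≤ (p.2 : EReal)}

/-- `r` is proper: nonempty effective domain, and the value `-∞` is not taken. -/
def IsProperFun (r : E → EReal) : Prop := (effDomain r).Nonempty ∧ ∀ x, r x ≠ ⊥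

/-- The regular (Fréchet) subdifferential: `r x' ≥ r x + ⟪y, x' - x⟫ + o(‖x' - x‖)`, for `x ∈ dom r`. -/
def regularSubdifferential (r : E → EReal) (x : E) : Set E :=
  {y | x ∈ effDomain r ∧ ∀ ε : ℝ, 0 < ε → ∀ᶠ x' in 𝓝 x,
    r x + ((inner ℝ y (x' - x) - ε * ‖x' - x‖ : ℝ) : EReal) ≤ r x'}

/-- The limiting (Mordukhovich) subdifferential at a point of the effective domain. -/
def limitingSubdifferential (r : E → EReal) (x : E) : Set E :=
  {y | x ∈ effDomain r ∧ ∃ xs ys : ℕ → E,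
    Filter.Tendsto xs Filter.atTop (𝓝 x) ∧
    Filter.Tendsto (fun k => r (xs k)) Filter.atTop (𝓝 (r x)) ∧
    (∀ k, ys k ∈ regularSubdifferential r (xs k)) ∧
    Filter.Tendsto ys Filter.atTop (𝓝 y)}

/-- `p` minimizes `u ↦ r u + ½‖u - x‖²`. -/
def IsProxPoint (r : E → EReal) (x p : E) : Prop :=
  ∀ u, r p + ((1 / 2 * ‖p - x‖ ^ 2 : ℝ) : EReal) ≤ r u + ((1 / 2 * ‖u - x‖ ^ 2 : ℝ) : EReal)

/-- The proximal mapping `Prox_r`, as a function: the minimizer of `u ↦ r u + ½‖u - x‖²`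
(which exists and is unique for `r` proper, lower semicontinuous and convex). -/
def proxMap (r : E → EReal) (x : E) : E :=
  Classical.epsilon (fun p => IsProxPoint r x p)

/-- The metric projection `Π_C`, as a function: the point of `C` nearest to `x`
(which exists and is unique for `C` nonempty, closed and convex). -/
def metricProj (C : Set E) (x : E) : E :=
  Classical.epsilon (fun p => p ∈ C ∧ ∀ q ∈ C, ‖x - p‖ ≤ ‖x - q‖)

open Classical in
/-- The indicator function `δ_C`. -/
def indicatorFun (C : Set E) (x : E) : EReal := if x ∈ C then 0 else ⊤

/-- The regular (Fréchet) normal cone to `C` at `x ∈ C`. -/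
def regularNormalCone (C : Set E) (x : E) : Set E :=
  {y | x ∈ C ∧ ∀ ε : ℝ, 0 < ε → ∀ᶠ x' in 𝓝[C] x, inner ℝ y (x' - x) ≤ ε * ‖x' - x‖}

/-- The limiting (Mordukhovich) normal cone to `C` at `x ∈ C`. -/
def limitingNormalCone (C : Set E) (x : E) : Set E :=
  {y | x ∈ C ∧ ∃ xs ys : ℕ → E,
    Filter.Tendsto xs Filter.atTop (𝓝 x) ∧
    (∀ k, xs k ∈ C ∧ ys k ∈ regularNormalCone C (xs k)) ∧
    Filter.Tendsto ys Filter.atTop (𝓝 y)}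

/-- The limiting Jacobian of `S` at `x`: limits of derivatives of `S` along sequences of points of
differentiability that converge to `x`. -/
def limitingJacobian (S : E → E) (x : E) : Set (E →L[ℝ] E) :=
  {V | ∃ xs : ℕ → E,
    (∀ k, DifferentiableAt ℝ S (xs k)) ∧
    Filter.Tendsto xs Filter.atTop (𝓝 x) ∧
    Filter.Tendsto (fun k => fderiv ℝ S (xs k)) Filter.atTop (𝓝 V)}

/-- Clarke's generalized Jacobian: the convex hull of the limiting Jacobian. -/
def clarkeJacobian (S : E → E) (x : E) : Set (E →L[ℝ] E) :=
  convexHull ℝ (limitingJacobian S x)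

/-- The union of the ranges of the elements of the generalized Jacobian of `S` at `x`. -/
def jacobianRange (S : E → E) (x : E) : Set E :=
  ⋃ W ∈ clarkeJacobian S x, Set.range W

/-- The values `⟪y, z - y⟫` over all `z` and all `W ∈ JS(x)` with `y = W z`. -/
def jacobianPairings (S : E → E) (x y : E) : Set ℝ :=
  {t | ∃ W ∈ clarkeJacobian S x, ∃ z, y = W z ∧ t = inner ℝ y (z - y)}

/-- For `r` proper, lower semicontinuous and convex with `u ∈ ∂r(x)`: a single `Wbar` in the limiting
Jacobian of `Prox_r` at `x + u` has as its range the union of the ranges over the generalized Jacobian,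
and attains, through some `zbar` with `y = Wbar zbar`, the minimum of `⟪y, z - y⟫` for each `y` in it. -/
def JacobianRangeCondition (r : E → EReal) (x u : E) : Prop :=
  LowerSemicontinuous r ∧ IsProperFun r ∧ Convex ℝ (epigraph r) ∧
  x ∈ effDomain r ∧ u ∈ limitingSubdifferential r x ∧
  ∃ Wbar ∈ limitingJacobian (proxMap r) (x + u),
    jacobianRange (proxMap r) (x + u) = Set.range Wbar ∧
    ∀ y ∈ jacobianRange (proxMap r) (x + u), ∃ zbar, y = Wbar zbar ∧
      IsLeast (jacobianPairings (proxMap r) (x + u) y) (inner ℝ y (zbar - y))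

end VariationalAnalysis

/-! ### Symmetric matrices -/

/-- The symmetric matrices inside `ℝ^(ι × ι)` with the Euclidean (i.e. Frobenius) inner product. -/
def symSubmodule (ι : Type*) [Fintype ι] : Submodule ℝ (EuclideanSpace ℝ (ι × ι)) where
  carrier := {x | ∀ i j, x (i, j) = x (j, i)}
  add_mem' := by
    intro a b ha hb i j
    simp [ha i j, hb i j]
  zero_mem' := by
    intro i j
    simp
  smul_mem' := by
    intro c a ha i j
    simp [ha i j]

/-- The Euclidean space of real symmetric matrices, with the Frobenius inner product. -/
abbrev SymMat (ι : Type*) [Fintype ι] : Type _ := ↥(symSubmodule ι)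

/-- The underlying matrix of an element of `SymMat ι`. -/
def SymMat.toMatrix {ι : Type*} [Fintype ι] (X : SymMat ι) : Matrix ι ι ℝ :=
  Matrix.of fun i j => X.1 (i, j)

theorem SymMat.inner_eq_trace {ι : Type*} [Fintype ι] (X Y : SymMat ι) :
    inner ℝ X Y = (X.toMatrixᵀ * Y.toMatrix).trace := by
  rw [Submodule.coe_inner, PiLp.inner_apply, Fintype.sum_prod_type_right]
  simp [Matrix.trace, Matrix.mul_apply, SymMat.toMatrix, mul_comm]

/-- The cone of positive-semidefinite matrices. -/
def psdCone (ι : Type*) [Fintype ι] : Set (SymMat ι) := {X | X.toMatrix.PosSemidef}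

/-- The weights `(max σᵢ 0 + max σⱼ 0) / (|σᵢ| + |σⱼ|)`, with `0 / 0 := 1`. -/
def eigWeight {ι : Type*} (σ : ι → ℝ) (i j : ι) : ℝ :=
  if |σ i| + |σ j| = 0 then 1 else (max (σ i) 0 + max (σ j) 0) / (|σ i| + |σ j|)

/-- With `α = {σ > 0}`, `β = {σ = 0}`, `γ = {σ < 0}`, the matrix with blocks
`[M_αα, M_αβ, Σ_αγ ∘ M_αγ; M_βα, M_ββ, 0; Σ_γα ∘ M_γα, 0, 0]`, where `Σ` is `eigWeight σ`. -/
def blockForm {ι : Type*} (σ : ι → ℝ) (M : Matrix ι ι ℝ) : Matrix ι ι ℝ :=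
  Matrix.of fun i j =>
    if 0 ≤ σ i ∧ 0 ≤ σ j then M i j
    else if (0 < σ i ∧ σ j < 0) ∨ (σ i < 0 ∧ 0 < σ j) then eigWeight σ i j * M i j
    else 0

end

/-! The argument needs no perturbation theory of eigenvalues. It rests on two properties of
projections and one algebraic identity.

The projection onto a closed convex set is firmly nonexpansive and is the gradient of `½‖x‖² - ½‖x -
Π x‖²`. Its derivatives are therefore self-adjoint and satisfy `‖W d‖² ≤ ⟪W d, d⟫`. Both properties
survive limits and convex combinations, so they hold on the whole generalized Jacobian
(`clarkeJacobian_metricProj_symm_and_norm_sq_le`).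

For the positive-semidefinite cone, `Π X * (Π X - X) = 0`. Linearizing this in an eigenbasis and
symmetrizing gives `(|σᵢ| + |σⱼ|) (W D)ᵢⱼ = (σᵢ⁺ + σⱼ⁺) Dᵢⱼ`. If no eigenvalue vanishes, the
quadratic remainder in this identity proves differentiability, with weights `eigWeight σ`. Replacing
the zero eigenvalues by `t ↓ 0` then places `weightedConj P (of (eigWeight σ))`, the map `Wbar`, in
the limiting Jacobian.

At a general point, the same identity fixes every entry of `W D` outside the `ββ` block
(`conj_clarkeJacobian_psdCone_apply`). By self-adjointness the `ββ` block decouples from the others,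
and by firm nonexpansiveness it contributes a nonnegative amount to `⟪W Z, Z - W Z⟫`
(`sum_zero_block_nonneg`). `Wbar` is the identity on that block, so there it contributes exactly
`0`; all other contributions depend on `Y` alone. This gives both the equality of ranges and the
minimum. -/

noncomputable section
/-! ### Metric projections onto closed convex sets -/

section Projection

open Filter Asymptotics

variable {E : Type*} [NormedAddCommGroup E] [InnerProductSpace ℝ E]

theorem hasFDerivAt_of_isBigO_norm_sub_sq {F G : Type*} [NormedAddCommGroup F] [NormedSpace ℝ F]
    [NormedAddCommGroup G] [NormedSpace ℝ G] {f : F → G} {f' : F →L[ℝ] G} {x : F}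
    (h : (fun y => f y - f x - f' (y - x)) =O[𝓝 x] fun y => ‖y - x‖ ^ 2) : HasFDerivAt f f' x := by
  refine HasFDerivAt.of_isLittleO (h.trans_isLittleO ?_)
  exact (isLittleO_norm_pow_id (E' := F) one_lt_two).comp_tendsto
    (show Tendsto (fun y => y - x) (𝓝 x) (𝓝 0) by simpa using (continuous_sub_right x).tendsto x)

/-- Expanding the square turns the variational inequality into `‖x - p‖² + ‖q - p‖² ≤ ‖x - q‖²`.
Hence `p` is the only nearest point, and the choice made in `metricProj` must return it. -/
theorem metricProj_eq_of_inner_le_zero {C : Set E} {x p : E} (hp : p ∈ C)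
    (h : ∀ q ∈ C, inner ℝ (x - p) (q - p) ≤ 0) : metricProj C x = p := by
  have key : ∀ q ∈ C, ‖x - p‖ ^ 2 + ‖q - p‖ ^ 2 ≤ ‖x - q‖ ^ 2 := by
    intro q hq
    have e : x - q = (x - p) - (q - p) := by abel
    have := h q hq
    rw [e, norm_sub_sq_real (x - p) (q - p)]
    linarith
  have hex : ∃ p, p ∈ C ∧ ∀ q ∈ C, ‖x - p‖ ≤ ‖x - q‖ :=
    ⟨p, hp, fun q hq => (sq_le_sq₀ (norm_nonneg _) (norm_nonneg _)).1 (by nlinarith [key q hq, sq_nonneg ‖q - p‖])⟩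
  obtain ⟨h1, h2⟩ := Classical.epsilon_spec hex
  have h3 := key _ h1
  have h4 := pow_le_pow_left₀ (norm_nonneg _) (h2 p hp) 2
  have h5 : ‖metricProj C x - p‖ = 0 := by
    have : ‖metricProj C x - p‖ ^ 2 ≤ 0 := by unfold metricProj; linarith
    exact pow_eq_zero_iff two_ne_zero |>.1 (le_antisymm this (sq_nonneg _))
  exact sub_eq_zero.1 (norm_eq_zero.1 h5)

theorem metricProj_mem_and_inner_le_zero [CompleteSpace E] {C : Set E} (hne : C.Nonempty)
    (hcl : IsClosed C) (hconv : Convex ℝ C) (x : E) :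
    metricProj C x ∈ C ∧
      ∀ q ∈ C, inner ℝ (x - metricProj C x) (q - metricProj C x) ≤ 0 := by
  obtain ⟨v, hv, hmin⟩ := exists_norm_eq_iInf_of_complete_convex hne hcl.isComplete hconv x
  have hi := (norm_eq_iInf_iff_real_inner_le_zero hconv hv).1 hmin
  rw [metricProj_eq_of_inner_le_zero hv hi]
  exact ⟨hv, hi⟩

/-- Completing the square. In the form of membership in a closed ball, the inequality is visibly
closed and convex in `w`, which is what passing to limits and convex hulls requires. -/
theorem norm_sq_le_inner_iff_mem_closedBall (x w : E) :
    ‖w‖ ^ 2 ≤ inner ℝ w x ↔ w ∈ Metric.closedBall ((1 / 2 : ℝ) • x) (1 / 2 * ‖x‖) := by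
  rw [mem_closedBall_iff_norm, ← sq_le_sq₀ (norm_nonneg _) (by positivity), norm_sub_sq_real,
    inner_smul_right, norm_smul, mul_pow, mul_pow]
  norm_num
  rw [← mul_assoc]
  norm_num

variable [CompleteSpace E] {C : Set E}

/-- The metric projection onto a closed convex set is firmly nonexpansive. -/
theorem metricProj_firmly_nonexpansive (hne : C.Nonempty) (hcl : IsClosed C)
    (hconv : Convex ℝ C) (x y : E) :
    ‖metricProj C x - metricProj C y‖ ^ 2 ≤ inner ℝ (metricProj C x - metricProj C y) (x - y) := by
  obtain ⟨hx, hx'⟩ := metricProj_mem_and_inner_le_zero hne hcl hconv x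
  obtain ⟨hy, hy'⟩ := metricProj_mem_and_inner_le_zero hne hcl hconv y
  have h1 := hx' _ hy
  have h2 := hy' _ hx
  rw [← real_inner_self_eq_norm_sq]
  simp only [inner_sub_left, inner_sub_right] at h1 h2 ⊢
  linarith [real_inner_comm x (metricProj C x), real_inner_comm y (metricProj C x),
    real_inner_comm x (metricProj C y), real_inner_comm y (metricProj C y)]

theorem norm_metricProj_sub_le (hne : C.Nonempty) (hcl : IsClosed C) (hconv : Convex ℝ C)
    (x y : E) : ‖metricProj C x - metricProj C y‖ ≤ ‖x - y‖ := by
  have h1 := metricProj_firmly_nonexpansive hne hcl hconv x y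
  have h2 := real_inner_le_norm (metricProj C x - metricProj C y) (x - y)
  by_contra! h
  nlinarith [norm_nonneg (x - y), norm_nonneg (metricProj C x - metricProj C y)]

theorem isBigO_metricProj_sub (hne : C.Nonempty) (hcl : IsClosed C) (hconv : Convex ℝ C)
    (x : E) : (fun y => metricProj C y - metricProj C x) =O[𝓝 x] fun y => y - x :=
  IsBigO.of_bound 1 (Eventually.of_forall fun y => by
    simpa using norm_metricProj_sub_le hne hcl hconv y x)

theorem continuous_metricProj (hne : C.Nonempty) (hcl : IsClosed C) (hconv : Convex ℝ C) :
    Continuous (metricProj C) :=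
  (LipschitzWith.of_dist_le_mul (K := 1) fun x y => by
    simpa [dist_eq_norm] using norm_metricProj_sub_le hne hcl hconv x y).continuous

theorem norm_sq_fderiv_metricProj_le (hne : C.Nonempty) (hcl : IsClosed C) (hconv : Convex ℝ C)
    {x : E} (hd : DifferentiableAt ℝ (metricProj C) x) (d : E) :
    ‖fderiv ℝ (metricProj C) x d‖ ^ 2 ≤ inner ℝ (fderiv ℝ (metricProj C) x d) d := by
  have hl : HasDerivAt (fun t : ℝ => metricProj C (x + t • d))
      (fderiv ℝ (metricProj C) x d) 0 := hd.hasFDerivAt.hasLineDerivAt d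
  have ht := hasDerivAt_iff_tendsto_slope.1 hl
  refine le_of_tendsto_of_tendsto (ht.norm.pow 2) (ht.inner tendsto_const_nhds) ?_
  filter_upwards [self_mem_nhdsWithin] with t ht0
  have ht0 : t ≠ 0 := ht0
  have h := metricProj_firmly_nonexpansive hne hcl hconv (x + t • d) x
  simp only [slope, sub_zero, zero_smul, add_zero, vsub_eq_sub, norm_smul, inner_smul_left,
    mul_pow]
  rw [add_sub_cancel_left, inner_smul_right] at h
  have h' := mul_le_mul_of_nonneg_left h (sq_nonneg t⁻¹)
  calc _ = t⁻¹ ^ 2 * ‖metricProj C (x + t • d) - metricProj C x‖ ^ 2 := by simp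
    _ ≤ _ := h'
    _ = _ := by simp; field_simp

/-- `½‖x‖² - ½‖x - Π x‖²` is differentiable with gradient `Π x`. -/
theorem hasFDerivAt_half_norm_sq_sub_dist_sq (hne : C.Nonempty) (hcl : IsClosed C)
    (hconv : Convex ℝ C) (x : E) :
    HasFDerivAt (fun y : E => 1 / 2 * ‖y‖ ^ 2 - 1 / 2 * ‖y - metricProj C y‖ ^ 2)
      (innerSL ℝ (metricProj C x)) x := by
  set φ : E → ℝ := fun y => 1 / 2 * ‖y‖ ^ 2 - 1 / 2 * ‖y - metricProj C y‖ ^ 2 with hφ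
  have hφ' : ∀ y, φ y = inner ℝ (metricProj C y) y - 1 / 2 * ‖metricProj C y‖ ^ 2 := by
    intro y
    simp only [hφ, norm_sub_sq_real, real_inner_comm]
    ring
  -- Subgradient inequality: `φ z` is the maximum over `q ∈ C` of `⟪q, z⟫ - ½‖q‖²`, tested here at
  -- `q = Π y`.
  have lower : ∀ y z, φ y + inner ℝ (metricProj C y) (z - y) ≤ φ z := by
    intro y z
    obtain ⟨hy, -⟩ := metricProj_mem_and_inner_le_zero hne hcl hconv y
    obtain ⟨-, hz'⟩ := metricProj_mem_and_inner_le_zero hne hcl hconv z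
    have h1 := hz' _ hy
    have e : ‖z - metricProj C y‖ ^ 2 = ‖z - metricProj C z‖ ^ 2 -
        2 * inner ℝ (z - metricProj C z) (metricProj C y - metricProj C z) +
        ‖metricProj C y - metricProj C z‖ ^ 2 := by
      rw [← norm_sub_sq_real]; congr 2; abel
    have h2 : ‖z - metricProj C z‖ ^ 2 ≤ ‖z - metricProj C y‖ ^ 2 := by
      nlinarith [sq_nonneg ‖metricProj C y - metricProj C z‖]
    rw [hφ' y]
    simp only [hφ]
    rw [norm_sub_sq_real z (metricProj C y), real_inner_comm] at h2
    rw [inner_sub_right]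
    linarith
  refine hasFDerivAt_of_isBigO_norm_sub_sq (IsBigO.of_bound 1 (Eventually.of_forall fun y => ?_))
  -- The two subgradient inequalities squeeze the remainder between `0` and `⟪Π y - Π x, y - x⟫ ≤ ‖y
  -- - x‖²`.
  have h1 := lower x y
  have h2 := lower y x
  have h3 := norm_metricProj_sub_le hne hcl hconv y x
  have h4 := real_inner_le_norm (metricProj C y - metricProj C x) (y - x)
  have e : x - y = -(y - x) := by abel
  rw [e, inner_neg_right] at h2
  rw [inner_sub_left] at h4
  rw [innerSL_apply_apply, Real.norm_of_nonneg (by linarith), Real.norm_of_nonneg (by positivity)]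
  nlinarith [norm_nonneg (y - x)]

/-- The derivative of a gradient field is a second derivative, hence symmetric. Differentiability of
the gradient at the single point `x` is enough, because the potential is differentiable everywhere.
-/
theorem inner_fderiv_metricProj_comm (hne : C.Nonempty) (hcl : IsClosed C) (hconv : Convex ℝ C)
    {x : E} (hd : DifferentiableAt ℝ (metricProj C) x) (d e : E) :
    inner ℝ (fderiv ℝ (metricProj C) x d) e = inner ℝ d (fderiv ℝ (metricProj C) x e) := by
  have h := second_derivative_symmetric
    (hasFDerivAt_half_norm_sq_sub_dist_sq hne hcl hconv)
    ((innerSL ℝ (E := E)).hasFDerivAt.comp x hd.hasFDerivAt) d e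
  change inner ℝ (fderiv ℝ (metricProj C) x d) e = inner ℝ (fderiv ℝ (metricProj C) x e) d at h
  rw [h, real_inner_comm]

/-- Every element of the generalized Jacobian of a metric projection is self-adjoint and
firmly nonexpansive. -/
theorem clarkeJacobian_metricProj_symm_and_norm_sq_le (hne : C.Nonempty) (hcl : IsClosed C)
    (hconv : Convex ℝ C) {x : E} {W : E →L[ℝ] E} (hW : W ∈ clarkeJacobian (metricProj C) x)
    (d e : E) :
    inner ℝ (W d) e = inner ℝ d (W e) ∧ ‖W d‖ ^ 2 ≤ inner ℝ (W d) d := by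
  let K : Set (E →L[ℝ] E) := {V | inner ℝ (V d) e = inner ℝ d (V e)}
  let K' : Set (E →L[ℝ] E) :=
    {V | V d ∈ Metric.closedBall ((1 / 2 : ℝ) • d) (1 / 2 * ‖d‖)}
  have hK : Convex ℝ K := by
    intro V hV V' hV' a b _ _ _
    simp only [K, Set.mem_ofPred_eq] at hV hV' ⊢
    simp [inner_add_left, inner_add_right, inner_smul_left, inner_smul_right, hV, hV']
  have hK' : Convex ℝ K' :=
    (convex_closedBall _ _).is_linear_preimage (f := fun V : E →L[ℝ] E => V d)
      ⟨fun _ _ => rfl, fun _ _ => rfl⟩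
  have hsub : limitingJacobian (metricProj C) x ⊆ K ∩ K' := by
    rintro V ⟨xs, hdiff, -, hV⟩
    have hv : ∀ d, Tendsto (fun k => fderiv ℝ (metricProj C) (xs k) d) atTop (𝓝 (V d)) :=
      fun d => ((ContinuousLinearMap.apply ℝ E d).continuous.tendsto V).comp hV
    refine ⟨tendsto_nhds_unique ((hv d).inner tendsto_const_nhds)
      ((tendsto_const_nhds.inner (hv e)).congr fun k =>
        (inner_fderiv_metricProj_comm hne hcl hconv (hdiff k) d e).symm), ?_⟩
    exact Metric.isClosed_closedBall.mem_of_tendsto (hv d) (Eventually.of_forall fun k =>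
      (norm_sq_le_inner_iff_mem_closedBall _ _).1
        (norm_sq_fderiv_metricProj_le hne hcl hconv (hdiff k) d))
  have := convexHull_min hsub (hK.inter hK') hW
  exact ⟨this.1, (norm_sq_le_inner_iff_mem_closedBall _ _).2 this.2⟩

end Projection

/-! ### Indicator functions -/

section Indicator

open Filter

variable {E : Type*} {C : Set E}

theorem indicatorFun_of_mem {x : E} (hx : x ∈ C) : indicatorFun C x = 0 := if_pos hx

theorem indicatorFun_of_notMem {x : E} (hx : x ∉ C) : indicatorFun C x = ⊤ := if_neg hx

theorem effDomain_indicatorFun : effDomain (indicatorFun C) = C := by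
  ext x
  by_cases hx : x ∈ C <;>
    simp [effDomain, hx, indicatorFun_of_mem, indicatorFun_of_notMem]

theorem isProperFun_indicatorFun (hne : C.Nonempty) : IsProperFun (indicatorFun C) := by
  refine ⟨effDomain_indicatorFun.symm ▸ hne, fun x => ?_⟩
  by_cases hx : x ∈ C <;> simp [hx, indicatorFun_of_mem, indicatorFun_of_notMem]

theorem epigraph_indicatorFun : epigraph (indicatorFun C) = C ×ˢ Set.Ici (0 : ℝ) := by
  ext ⟨x, t⟩
  by_cases hx : x ∈ C <;>
    simp [epigraph, hx, indicatorFun_of_mem, indicatorFun_of_notMem]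

theorem lowerSemicontinuous_indicatorFun [TopologicalSpace E] (hcl : IsClosed C) :
    LowerSemicontinuous (indicatorFun C) := by
  intro x a ha
  by_cases hx : x ∈ C
  · rw [indicatorFun_of_mem hx] at ha
    refine Eventually.of_forall fun y => ha.trans_le ?_
    by_cases hy : y ∈ C <;> simp [hy, indicatorFun_of_mem, indicatorFun_of_notMem]
  · rw [indicatorFun_of_notMem hx] at ha
    filter_upwards [hcl.isOpen_compl.mem_nhds hx] with y hy
    rwa [indicatorFun_of_notMem hy]

/-- The proximal mapping of an indicator function is the metric projection. -/
theorem proxMap_indicatorFun [NormedAddCommGroup E] (hne : C.Nonempty) : proxMap (indicatorFun C) = metricProj C := by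
  funext x
  unfold proxMap metricProj
  congr 1
  funext p
  have hle : ∀ q, (1 / 2 * ‖p - x‖ ^ 2 ≤ 1 / 2 * ‖q - x‖ ^ 2) ↔ ‖x - p‖ ≤ ‖x - q‖ := by
    intro q
    rw [mul_le_mul_iff_right₀ (by norm_num), sq_le_sq₀ (norm_nonneg _) (norm_nonneg _),
      norm_sub_rev p, norm_sub_rev q]
  apply propext
  constructor
  · intro h
    have hp : p ∈ C := by
      by_contra hp
      obtain ⟨q, hq⟩ := hne
      have := h q
      rw [indicatorFun_of_mem hq, indicatorFun_of_notMem hp, EReal.top_add_coe, zero_add] at this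
      exact absurd this (not_le.2 (EReal.coe_lt_top _))
    refine ⟨hp, fun q hq => (hle q).1 ?_⟩
    have := h q
    rw [indicatorFun_of_mem hq, indicatorFun_of_mem hp, zero_add, zero_add] at this
    exact_mod_cast this
  · rintro ⟨hp, h⟩ q
    by_cases hq : q ∈ C
    · rw [indicatorFun_of_mem hq, indicatorFun_of_mem hp, zero_add, zero_add]
      exact_mod_cast (hle q).2 (h q hq)
    · rw [indicatorFun_of_notMem hq, EReal.top_add_coe]
      exact le_top

/-- The same sequences serve on both sides: on `C` the two regular inequalities coincide, and off
`C` the value `⊤` makes the subgradient inequality trivial. -/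
theorem limitingNormalCone_subset_limitingSubdifferential [NormedAddCommGroup E]
    [InnerProductSpace ℝ E] (x : E) :
    limitingNormalCone C x ⊆ limitingSubdifferential (indicatorFun C) x := by
  rintro y ⟨hx, xs, ys, hxs, hmem, hys⟩
  refine ⟨effDomain_indicatorFun.symm ▸ hx, xs, ys, hxs, ?_, fun k => ?_, hys⟩
  · simp only [indicatorFun_of_mem hx, indicatorFun_of_mem (hmem _).1]
    exact tendsto_const_nhds
  · obtain ⟨hk, -, hN⟩ := hmem k
    refine ⟨effDomain_indicatorFun.symm ▸ hk, fun ε hε => ?_⟩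
    filter_upwards [eventually_nhdsWithin_iff.1 (hN ε hε)] with z hz
    by_cases hzC : z ∈ C
    · rw [indicatorFun_of_mem hk, indicatorFun_of_mem hzC, zero_add]
      exact_mod_cast sub_nonpos.2 (hz hzC)
    · rw [indicatorFun_of_notMem hzC]
      exact le_top

end Indicator

end

noncomputable section
/-! ### Symmetric matrices -/

section SymmetricMatrices

open Filter Asymptotics Matrix

variable {ι : Type*} [Fintype ι]

namespace SymMat

@[simp] theorem toMatrix_apply (X : SymMat ι) (i j : ι) : X.toMatrix i j = X.1 (i, j) := rfl

@[simp] theorem toMatrix_add (X Y : SymMat ι) : (X + Y).toMatrix = X.toMatrix + Y.toMatrix := rfl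

@[simp] theorem toMatrix_sub (X Y : SymMat ι) : (X - Y).toMatrix = X.toMatrix - Y.toMatrix := rfl

@[simp] theorem toMatrix_smul (c : ℝ) (X : SymMat ι) : (c • X).toMatrix = c • X.toMatrix := rfl

@[simp] theorem toMatrix_zero : (0 : SymMat ι).toMatrix = 0 := rfl

theorem transpose_toMatrix (X : SymMat ι) : X.toMatrixᵀ = X.toMatrix := by
  ext i j
  exact X.2 j i

theorem toMatrix_injective : Function.Injective (toMatrix : SymMat ι → Matrix ι ι ℝ) := by
  intro X Y h
  ext ⟨i, j⟩
  exact congrFun (congrFun h i) j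

/-- The entries of a symmetric matrix, as continuous linear functionals. -/
def entry (i j : ι) : SymMat ι →L[ℝ] ℝ :=
  (EuclideanSpace.proj (i, j)).comp (symSubmodule ι).subtypeL

theorem entry_apply (i j : ι) (X : SymMat ι) : entry i j X = X.toMatrix i j := rfl

theorem continuous_toMatrix : Continuous (toMatrix : SymMat ι → Matrix ι ι ℝ) :=
  continuous_matrix fun i j => (entry i j).continuous

/-- The symmetric part of a matrix. -/
def symmetricPart : Matrix ι ι ℝ →ₗ[ℝ] SymMat ι where
  toFun M := ⟨WithLp.toLp 2 fun p => (M p.1 p.2 + M p.2 p.1) / 2, fun i j => by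
    simp [add_comm]⟩
  map_add' M N := by
    ext p
    simp
    ring
  map_smul' c M := by
    ext p
    simp
    ring

theorem toMatrix_symmetricPart {M : Matrix ι ι ℝ} (hM : Mᵀ = M) :
    (symmetricPart M).toMatrix = M := by
  ext i j
  have : M j i = M i j := congrFun (congrFun hM i) j
  change (M i j + M j i) / 2 = M i j
  rw [this]
  ring

theorem isBigO_of_entries {α F : Type*} [SeminormedAddCommGroup F] {l : Filter α}
    {f : α → SymMat ι} {g : α → F} (h : ∀ i j, (fun x => (f x).toMatrix i j) =O[l] g) : f =O[l] g := by
  have h1 : (fun x => (EuclideanSpace.equiv (ι × ι) ℝ) (f x).1) =O[l] g :=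
    isBigO_pi.2 fun p => h p.1 p.2
  have h2 : (fun x => (f x).1) =O[l] g := by
    have := ((EuclideanSpace.equiv (ι × ι) ℝ).symm.toContinuousLinearMap.isBigO_comp
      (fun x => (EuclideanSpace.equiv (ι × ι) ℝ) (f x).1) l).trans h1
    simpa using this
  exact (isBigO_norm_left.1 (by simpa using h2.norm_left))

end SymMat

open SymMat

theorem isBigO_matrix_mul {α F : Type*} [SeminormedAddCommGroup F] {l : Filter α}
    (A : Matrix ι ι ℝ) {M : α → Matrix ι ι ℝ} (B : Matrix ι ι ℝ) {g : α → F}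
    (h : ∀ i j, (fun x => M x i j) =O[l] g) (i j : ι) : (fun x => (A * M x * B) i j) =O[l] g := by
  have h1 : ∀ k, (fun x => (A * M x) i k) =O[l] g := fun k => by
    simp only [Matrix.mul_apply]
    exact IsBigO.fun_sum fun k' _ => (h k' k).const_mul_left (A i k')
  simp only [Matrix.mul_apply (N := B)]
  refine IsBigO.fun_sum fun k _ => ?_
  simpa only [mul_comm] using (h1 k).const_mul_left (B k j)

theorem SymMat.conj_apply_comm (P : Matrix ι ι ℝ) (X : SymMat ι) (i j : ι) :
    (Pᵀ * X.toMatrix * P) j i = (Pᵀ * X.toMatrix * P) i j := by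
  have h : (Pᵀ * X.toMatrix * P)ᵀ = Pᵀ * X.toMatrix * P := by
    rw [transpose_mul, transpose_mul, transpose_transpose, transpose_toMatrix, mul_assoc]
  exact congrFun (congrFun h i) j

/-! ### The cone of positive-semidefinite matrices -/

theorem mem_psdCone_iff {X : SymMat ι} :
    X ∈ psdCone ι ↔ ∀ v : ι → ℝ, 0 ≤ v ⬝ᵥ (X.toMatrix *ᵥ v) := by
  have h : X.toMatrix.IsHermitian := by
    rw [IsHermitian, conjTranspose_eq_transpose_of_trivial]
    exact X.transpose_toMatrix
  change X.toMatrix.PosSemidef ↔ _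
  simp only [posSemidef_iff_dotProduct_mulVec, h, true_and, star_trivial]

theorem psdCone_nonempty : (psdCone ι).Nonempty :=
  ⟨0, mem_psdCone_iff.2 fun v => by simp⟩

theorem isClosed_psdCone : IsClosed (psdCone ι) := by
  have : psdCone ι = ⋂ v : ι → ℝ, {X | 0 ≤ v ⬝ᵥ (X.toMatrix *ᵥ v)} := by
    ext X
    simp [mem_psdCone_iff]
  rw [this]
  exact isClosed_iInter fun v => isClosed_le continuous_const
    (continuous_const.dotProduct (continuous_toMatrix.matrix_mulVec continuous_const))

theorem convex_psdCone : Convex ℝ (psdCone ι) := by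
  intro X hX Y hY a b ha hb _
  rw [mem_psdCone_iff] at *
  intro v
  rw [toMatrix_add, toMatrix_smul, toMatrix_smul, add_mulVec, smul_mulVec, smul_mulVec,
    dotProduct_add, dotProduct_smul, dotProduct_smul]
  exact add_nonneg (mul_nonneg ha (hX v)) (mul_nonneg hb (hY v))

/-! ### Orthogonal coordinates -/

variable [DecidableEq ι]

theorem transpose_mul_self_of_mem_orthogonalGroup {P : Matrix ι ι ℝ}
    (hP : P ∈ orthogonalGroup ι ℝ) : Pᵀ * P = 1 := (mem_orthogonalGroup_iff' ι ℝ).1 hP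

theorem mul_transpose_self_of_mem_orthogonalGroup {P : Matrix ι ι ℝ}
    (hP : P ∈ orthogonalGroup ι ℝ) : P * Pᵀ = 1 := (mem_orthogonalGroup_iff ι ℝ).1 hP

theorem transpose_mul_mul_of_eq {P M N : Matrix ι ι ℝ} (hP : P ∈ orthogonalGroup ι ℝ)
    (h : N = P * M * Pᵀ) : Pᵀ * N * P = M := by
  rw [h, show Pᵀ * (P * M * Pᵀ) * P = (Pᵀ * P) * M * (Pᵀ * P) by noncomm_ring,
    transpose_mul_self_of_mem_orthogonalGroup hP, one_mul, mul_one]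

theorem eq_mul_mul_transpose_of_eq {P M N : Matrix ι ι ℝ} (hP : P ∈ orthogonalGroup ι ℝ)
    (h : Pᵀ * N * P = M) : N = P * M * Pᵀ := by
  rw [← h, show P * (Pᵀ * N * P) * Pᵀ = (P * Pᵀ) * N * (P * Pᵀ) by noncomm_ring,
    mul_transpose_self_of_mem_orthogonalGroup hP, one_mul, mul_one]

theorem transpose_mul_mul_mul {P : Matrix ι ι ℝ} (hP : P ∈ orthogonalGroup ι ℝ)
    (M N : Matrix ι ι ℝ) : Pᵀ * (M * N) * P = (Pᵀ * M * P) * (Pᵀ * N * P) := by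
  rw [show (Pᵀ * M * P) * (Pᵀ * N * P) = Pᵀ * (M * (P * Pᵀ) * N) * P by noncomm_ring,
    mul_transpose_self_of_mem_orthogonalGroup hP, mul_one]

theorem SymMat.inner_eq_sum_conj {P : Matrix ι ι ℝ} (hP : P ∈ orthogonalGroup ι ℝ)
    (X Y : SymMat ι) : inner ℝ X Y =
      ∑ i, ∑ j, (Pᵀ * X.toMatrix * P) i j * (Pᵀ * Y.toMatrix * P) i j := by
  have h : ∀ M N : Matrix ι ι ℝ, ∑ i, ∑ j, M i j * N i j = (Mᵀ * N).trace := by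
    intro M N
    rw [Finset.sum_comm]
    simp [Matrix.trace, Matrix.mul_apply]
  rw [inner_eq_trace, h]
  have e : (Pᵀ * X.toMatrix * P)ᵀ = Pᵀ * X.toMatrixᵀ * P := by
    rw [transpose_mul, transpose_mul, transpose_transpose, mul_assoc]
  rw [e, ← transpose_mul_mul_mul hP, trace_mul_cycle,
    mul_transpose_self_of_mem_orthogonalGroup hP, one_mul]

/-- The symmetric matrix with a given (symmetric) matrix in the coordinates of `P`. -/
theorem SymMat.exists_conj_eq {P M : Matrix ι ι ℝ} (hP : P ∈ orthogonalGroup ι ℝ)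
    (hM : Mᵀ = M) : ∃ D : SymMat ι, Pᵀ * D.toMatrix * P = M := by
  refine ⟨symmetricPart (P * M * Pᵀ), transpose_mul_mul_of_eq hP (toMatrix_symmetricPart ?_)⟩
  rw [transpose_mul, transpose_mul, transpose_transpose, hM, mul_assoc]

theorem SymMat.exists_diagonalization (X : SymMat ι) :
    ∃ P ∈ orthogonalGroup ι ℝ, ∃ σ : ι → ℝ, X.toMatrix = P * diagonal σ * Pᵀ := by
  have hX : X.toMatrix.IsHermitian := by
    rw [IsHermitian, conjTranspose_eq_transpose_of_trivial]
    exact X.transpose_toMatrix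
  refine ⟨hX.eigenvectorUnitary, hX.eigenvectorUnitary.2, hX.eigenvalues, ?_⟩
  have := hX.spectral_theorem
  rw [Unitary.conjStarAlgAut_apply] at this
  simpa [star_eq_conjTranspose, conjTranspose_eq_transpose_of_trivial] using this

/-! ### The projection onto the positive-semidefinite cone -/

/-- The positive-semidefinite projection of `P (Diag σ) Pᵀ` is `P (Diag σ⁺) Pᵀ`. -/
theorem conj_metricProj_psdCone {P : Matrix ι ι ℝ} {σ : ι → ℝ} {X : SymMat ι}
    (hP : P ∈ orthogonalGroup ι ℝ) (hX : X.toMatrix = P * diagonal σ * Pᵀ) :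
    Pᵀ * (metricProj (psdCone ι) X).toMatrix * P = diagonal fun i => max (σ i) 0 := by
  obtain ⟨Q, hQ⟩ := exists_conj_eq (M := diagonal fun i => max (σ i) 0) hP (diagonal_transpose _)
  have hX' := transpose_mul_mul_of_eq hP hX
  rw [metricProj_eq_of_inner_le_zero (p := Q) ?_ ?_, hQ]
  · change Q.toMatrix.PosSemidef
    rw [eq_mul_mul_transpose_of_eq hP hQ, ← conjTranspose_eq_transpose_of_trivial]
    exact (posSemidef_diagonal_iff.2 fun i => le_max_right _ _).mul_mul_conjTranspose_same P
  · intro Z hZ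
    -- In the coordinates of `P`, `X - Q` is diagonal with entries `min (σ i) 0`. Only the diagonal
    -- of `Z` matters, and it is nonnegative.
    rw [inner_eq_sum_conj hP]
    have hZ' : ∀ i, 0 ≤ (Pᵀ * Z.toMatrix * P) i i := fun i => by
      have : Z.toMatrix.PosSemidef := hZ
      simpa [conjTranspose_eq_transpose_of_trivial] using
        (this.conjTranspose_mul_mul_same P).diag_nonneg (i := i)
    refine Finset.sum_nonpos fun i _ => ?_
    simp only [toMatrix_sub, mul_sub, sub_mul, hX', hQ]
    rw [Finset.sum_eq_single i (fun j _ hj => by simp [diagonal_apply_ne _ hj.symm]) (by simp)]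
    simp only [Matrix.sub_apply, diagonal_apply_eq]
    rcases le_total (σ i) 0 with h | h
    · rw [max_eq_right h]
      nlinarith [hZ' i]
    · rw [max_eq_left h]
      simp

/-- Complementarity of the positive and the negative part of a symmetric matrix. -/
theorem metricProj_psdCone_mul_sub (X : SymMat ι) :
    (metricProj (psdCone ι) X).toMatrix *
      ((metricProj (psdCone ι) X).toMatrix - X.toMatrix) = 0 := by
  obtain ⟨P, hP, σ, hX⟩ := X.exists_diagonalization
  rw [eq_mul_mul_transpose_of_eq hP (M := 0) (N := _ * _) ?_, mul_zero, zero_mul]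
  rw [transpose_mul_mul_mul hP, mul_sub, sub_mul, conj_metricProj_psdCone hP hX,
    transpose_mul_mul_of_eq hP hX, diagonal_sub, diagonal_mul_diagonal, diagonal_eq_zero]
  funext i
  rcases le_total (σ i) 0 with h | h <;> simp [h]

end SymmetricMatrices

end

noncomputable section
/-! ### Differentiating the projection onto the positive-semidefinite cone -/

section PsdProjectionDerivative

open Filter Asymptotics Matrix SymMat

theorem eigWeight_comm {ι : Type*} (σ : ι → ℝ) (i j : ι) : eigWeight σ j i = eigWeight σ i j := by
  simp only [eigWeight, add_comm]

theorem eigWeight_mul_eq {ι : Type*} {σ : ι → ℝ} {i j : ι} (h : |σ i| + |σ j| ≠ 0) :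
    (|σ i| + |σ j|) * eigWeight σ i j = max (σ i) 0 + max (σ j) 0 := by
  rw [eigWeight, if_neg h]
  field_simp

/-- The convention `0 / 0 := 1` is exactly the limit of `(t + t) / (t + t)` from the right.
Elsewhere the denominator has a nonzero limit. -/
theorem tendsto_eigWeight {ι : Type*} (σ : ι → ℝ) (i j : ι) :
    Tendsto (fun t : ℝ => eigWeight (fun k => if σ k = 0 then t else σ k) i j) (𝓝[>] 0)
      (𝓝 (eigWeight σ i j)) := by
  by_cases h : |σ i| + |σ j| = 0
  · have hi : σ i = 0 := abs_eq_zero.1 (by linarith [abs_nonneg (σ i), abs_nonneg (σ j)])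
    have hj : σ j = 0 := abs_eq_zero.1 (by linarith [abs_nonneg (σ i), abs_nonneg (σ j)])
    refine tendsto_const_nhds.congr' ?_
    filter_upwards [self_mem_nhdsWithin] with t ht
    have ht : 0 < t := ht
    simp only [eigWeight, hi, hj, if_true, abs_zero, add_zero, abs_of_pos ht, max_eq_left ht.le]
    rw [if_neg (by positivity), div_self (by positivity)]
  · let s : ι → ℝ → ℝ := fun k t => if σ k = 0 then t else σ k
    have hs : ∀ k, Tendsto (s k) (𝓝[>] 0) (𝓝 (σ k)) := by
      intro k
      by_cases hk : σ k = 0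
      · simp only [s, hk, if_true]
        exact tendsto_nhdsWithin_of_tendsto_nhds tendsto_id
      · simp [s, hk]
    have hd : Tendsto (fun t => |s i t| + |s j t|) (𝓝[>] 0) (𝓝 (|σ i| + |σ j|)) :=
      (hs i).abs.add (hs j).abs
    rw [show eigWeight σ i j = (max (σ i) 0 + max (σ j) 0) / (|σ i| + |σ j|) from if_neg h]
    refine ((((hs i).max tendsto_const_nhds).add ((hs j).max tendsto_const_nhds)).div hd h).congr' ?_
    filter_upwards [hd.eventually_ne h] with t ht
    exact (if_neg ht).symm

theorem two_mul_max_sub (x : ℝ) : 2 * max x 0 - x = |x| := by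
  rcases le_total x 0 with h | h
  · simp [h, abs_of_nonpos]
  · rw [max_eq_left h, abs_of_nonneg h]
    ring

variable {ι : Type*} [Fintype ι]

/-- The map `D ↦ P (w ∘ (Pᵀ D P)) Pᵀ`, with `∘` the entrywise product. -/
def weightedConj (P w : Matrix ι ι ℝ) : SymMat ι →L[ℝ] SymMat ι :=
  LinearMap.toContinuousLinearMap
    { toFun := fun D => symmetricPart (P * (w ⊙ (Pᵀ * D.toMatrix * P)) * Pᵀ)
      map_add' := fun D D' => by
        rw [← map_add, toMatrix_add, mul_add, add_mul, hadamard_add, mul_add, add_mul]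
      map_smul' := fun c D => by
        rw [toMatrix_smul, Matrix.mul_smul, smul_mul, hadamard_smul, Matrix.mul_smul, smul_mul,
          map_smul, RingHom.id_apply] }

theorem weightedConj_apply (P w : Matrix ι ι ℝ) (D : SymMat ι) :
    weightedConj P w D = symmetricPart (P * (w ⊙ (Pᵀ * D.toMatrix * P)) * Pᵀ) := rfl

theorem toMatrix_weightedConj (P : Matrix ι ι ℝ) {w : Matrix ι ι ℝ} (hw : ∀ i j, w j i = w i j)
    (D : SymMat ι) :
    (weightedConj P w D).toMatrix = P * (w ⊙ (Pᵀ * D.toMatrix * P)) * Pᵀ := by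
  rw [weightedConj_apply, toMatrix_symmetricPart]
  have : (w ⊙ (Pᵀ * D.toMatrix * P))ᵀ = w ⊙ (Pᵀ * D.toMatrix * P) := by
    ext i j
    simp only [transpose_apply, hadamard_apply, hw i j, conj_apply_comm P D i j]
  rw [transpose_mul, transpose_mul, transpose_transpose, this, ← mul_assoc]

theorem continuous_weightedConj (P : Matrix ι ι ℝ) : Continuous (weightedConj P) := by
  refine continuous_clm_apply.2 fun D => ?_
  simp only [weightedConj_apply]
  have hl : Continuous (symmetricPart : Matrix ι ι ℝ →ₗ[ℝ] SymMat ι) :=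
    LinearMap.continuous_of_finiteDimensional _
  refine hl.comp ((continuous_const.matrix_mul ?_).matrix_mul continuous_const)
  exact continuous_matrix fun i j => (continuous_id.matrix_elem i j).mul continuous_const

variable [DecidableEq ι]

/-- Adding the `(i, j)` and `(j, i)` entries of the linearized complementarity makes the coefficient
of `Y i j` equal to a sum of terms `2σ⁺ - σ = |σ|`. With `G = 0` it is the exact equation for
derivatives; otherwise `G` carries the remainder. -/
theorem abs_add_abs_mul_of_complementarity {σ : ι → ℝ} {Y D G : Matrix ι ι ℝ}
    (hY : ∀ i j, Y j i = Y i j) (hD : ∀ i j, D j i = D i j)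
    (h : (diagonal fun i => max (σ i) 0) * (Y - D) +
      Y * ((diagonal fun i => max (σ i) 0) - diagonal σ) + G = 0) (i j : ι) :
    (|σ i| + |σ j|) * Y i j = (max (σ i) 0 + max (σ j) 0) * D i j - (G i j + G j i) := by
  have h' : ∀ i j, max (σ i) 0 * (Y i j - D i j) + Y i j * (max (σ j) 0 - σ j) + G i j = 0 := by
    intro i j
    have := congrFun (congrFun h i) j
    rw [diagonal_sub] at this
    simpa only [Matrix.add_apply, diagonal_mul, mul_diagonal, Matrix.sub_apply,
      Matrix.zero_apply] using this
  have h1 := h' i j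
  have h2 := h' j i
  rw [hY i j, hD i j] at h2
  rw [← two_mul_max_sub (σ i), ← two_mul_max_sub (σ j)]
  linear_combination h1 + h2

/-- At a symmetric matrix without zero eigenvalues, the projection onto the
positive-semidefinite cone is differentiable, with an explicit derivative. -/
theorem hasFDerivAt_metricProj_psdCone {P : Matrix ι ι ℝ} {σ : ι → ℝ} {X : SymMat ι}
    (hP : P ∈ orthogonalGroup ι ℝ) (hX : X.toMatrix = P * diagonal σ * Pᵀ) (hσ : ∀ i, σ i ≠ 0) :
    HasFDerivAt (metricProj (psdCone ι)) (weightedConj P (of (eigWeight σ))) X := by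
  set L := weightedConj P (of (eigWeight σ))
  set proj := metricProj (psdCone ι) with h_proj
  have hXσ := transpose_mul_mul_of_eq hP hX
  have h_projσ : Pᵀ * (proj X).toMatrix * P = diagonal fun i => max (σ i) 0 :=
    conj_metricProj_psdCone hP hX
  -- The second-order part of the difference of the complementarity identities at `Z` and `X`. It is
  -- quadratic in `Z - X` because the projection is Lipschitz.
  let G : SymMat ι → Matrix ι ι ℝ := fun Z =>
    (proj Z - proj X).toMatrix * (proj Z - proj X - (Z - X)).toMatrix
  have hG : ∀ i j, (fun Z => (Pᵀ * G Z * P) i j) =O[𝓝 X] fun Z => ‖Z - X‖ ^ 2 := by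
    have hb : (fun Z => proj Z - proj X) =O[𝓝 X] fun Z => ‖Z - X‖ :=
      (isBigO_metricProj_sub (E := SymMat ι) psdCone_nonempty isClosed_psdCone
        convex_psdCone X).norm_right
    have hb' : (fun Z => proj Z - proj X - (Z - X)) =O[𝓝 X] fun Z => ‖Z - X‖ :=
      hb.sub (isBigO_refl (fun Z => Z - X) _).norm_right
    refine isBigO_matrix_mul _ _ fun i j => ?_
    simp only [G, Matrix.mul_apply, pow_two]
    refine IsBigO.fun_sum fun k _ => ?_
    exact (((entry i k).isBigO_comp _ _).trans hb).mul (((entry k j).isBigO_comp _ _).trans hb')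
  -- Since no eigenvalue vanishes, one may divide by `|σ i| + |σ j|`, which writes the linearization
  -- error exactly in terms of `G`.
  have key : ∀ Z, ∀ i j, (Pᵀ * (proj Z - proj X - L (Z - X)).toMatrix * P) i j =
      -((|σ i| + |σ j|)⁻¹ * ((Pᵀ * G Z * P) i j + (Pᵀ * G Z * P) j i)) := by
    intro Z i j
    have hne : |σ i| + |σ j| ≠ 0 :=
      (add_pos (abs_pos.2 (hσ i)) (abs_pos.2 (hσ j))).ne'
    have h0 : (proj X).toMatrix * ((proj Z - proj X) - (Z - X)).toMatrix +
        (proj Z - proj X).toMatrix * ((proj X).toMatrix - X.toMatrix) + G Z = 0 := by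
      have h1 := metricProj_psdCone_mul_sub Z
      have h2 := metricProj_psdCone_mul_sub X
      rw [← sub_eq_zero.2 (h1.trans h2.symm)]
      simp only [G, toMatrix_sub, h_proj]
      noncomm_ring
    have h3 : (diagonal fun i => max (σ i) 0) *
          (Pᵀ * (proj Z - proj X).toMatrix * P - Pᵀ * (Z - X).toMatrix * P) +
        (Pᵀ * (proj Z - proj X).toMatrix * P) * ((diagonal fun i => max (σ i) 0) - diagonal σ) +
        Pᵀ * G Z * P = 0 := by
      rw [← h_projσ, ← hXσ, ← sub_mul, ← sub_mul, ← mul_sub, ← mul_sub, ← toMatrix_sub,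
        ← transpose_mul_mul_mul hP, ← transpose_mul_mul_mul hP, ← add_mul, ← mul_add, ← add_mul,
        ← mul_add, h0, mul_zero, zero_mul]
    have h4 := abs_add_abs_mul_of_complementarity (conj_apply_comm P _) (conj_apply_comm P _) h3 i j
    have h5 : Pᵀ * (L (Z - X)).toMatrix * P = of (eigWeight σ) ⊙ (Pᵀ * (Z - X).toMatrix * P) :=
      transpose_mul_mul_of_eq hP (toMatrix_weightedConj P (fun i j => eigWeight_comm σ i j) _)
    rw [toMatrix_sub, mul_sub, sub_mul, h5, Matrix.sub_apply, hadamard_apply, of_apply]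
    rw [← eigWeight_mul_eq hne] at h4
    field_simp
    linear_combination h4
  refine hasFDerivAt_of_isBigO_norm_sub_sq (isBigO_of_entries fun i j => ?_)
  have h := isBigO_matrix_mul P (l := 𝓝 X) (g := fun Z => ‖Z - X‖ ^ 2)
    (M := fun Z => Pᵀ * (proj Z - proj X - L (Z - X)).toMatrix * P) Pᵀ (fun i j => by
      simp only [key]
      exact (((hG i j).add (hG j i)).const_mul_left _).neg_left) i j
  exact h.congr_left fun Z => by rw [← eq_mul_mul_transpose_of_eq hP rfl]

/-- The map with weights `eigWeight σ` belongs to the limiting Jacobian of the projection onto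
the positive-semidefinite cone. -/
theorem weightedConj_mem_limitingJacobian {P : Matrix ι ι ℝ} {σ : ι → ℝ} {X : SymMat ι}
    (hP : P ∈ orthogonalGroup ι ℝ) (hX : X.toMatrix = P * diagonal σ * Pᵀ) :
    weightedConj P (of (eigWeight σ)) ∈ limitingJacobian (metricProj (psdCone ι)) X := by
  -- Zero eigenvalues are moved to the positive side, so that the limiting map is the identity on
  -- the zero block.
  let s : ℝ → ι → ℝ := fun t k => if σ k = 0 then t else σ k
  let A : ℝ → SymMat ι := fun t => symmetricPart (P * diagonal (s t) * Pᵀ)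
  have hA : ∀ t, (A t).toMatrix = P * diagonal (s t) * Pᵀ := fun t =>
    toMatrix_symmetricPart (by
      rw [transpose_mul, transpose_mul, transpose_transpose, diagonal_transpose, mul_assoc])
  have hA0 : A 0 = X := toMatrix_injective (by
    rw [hA, hX]
    congr 3
    funext k
    by_cases hk : σ k = 0 <;> simp [s, hk])
  have hAc : Continuous A := by
    have hl : Continuous (symmetricPart : Matrix ι ι ℝ →ₗ[ℝ] SymMat ι) :=
      LinearMap.continuous_of_finiteDimensional _
    refine hl.comp ((continuous_const.matrix_mul (Continuous.matrix_diagonal ?_)).matrix_mul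
      continuous_const)
    refine continuous_pi fun k => ?_
    by_cases hk : σ k = 0
    · simp only [s, hk, if_true]
      exact continuous_id
    · simp only [s, hk, if_false]
      exact continuous_const
  have hderiv : ∀ t, 0 < t → HasFDerivAt (metricProj (psdCone ι))
      (weightedConj P (of (eigWeight (s t)))) (A t) := fun t ht =>
    hasFDerivAt_metricProj_psdCone hP (hA t) fun k => by
      by_cases hk : σ k = 0
      · simpa [s, hk] using ht.ne'
      · simp [s, hk]
  obtain ⟨u, -, hu, hu0⟩ := exists_seq_strictAnti_tendsto (0 : ℝ)
  have hu' : Tendsto u atTop (𝓝[>] 0) :=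
    tendsto_nhdsWithin_iff.2 ⟨hu0, Eventually.of_forall hu⟩
  refine ⟨fun k => A (u k), fun k => (hderiv _ (hu k)).differentiableAt, ?_, ?_⟩
  · rw [← hA0]
    exact (hAc.tendsto 0).comp hu0
  · simp only [(hderiv _ (hu _)).fderiv]
    refine ((continuous_weightedConj P).tendsto _).comp ?_
    refine tendsto_pi_nhds.2 fun i => tendsto_pi_nhds.2 fun j => ?_
    exact (tendsto_eigWeight σ i j).comp hu'

end PsdProjectionDerivative

end

noncomputable section
/-! ### The generalized Jacobian of the projection onto the positive-semidefinite cone -/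

section PsdProjectionJacobian

open Filter Matrix SymMat

theorem eigWeight_of_nonneg {ι : Type*} {σ : ι → ℝ} {i j : ι} (hi : 0 ≤ σ i) (hj : 0 ≤ σ j) :
    eigWeight σ i j = 1 := by
  unfold eigWeight
  split_ifs with h
  · rfl
  · rw [max_eq_left hi, max_eq_left hj, ← abs_of_nonneg hi, ← abs_of_nonneg hj, abs_abs, abs_abs,
      div_self h]

theorem eigWeight_of_pos_of_neg {ι : Type*} {σ : ι → ℝ} {i j : ι} (hi : 0 < σ i) (hj : σ j < 0) :
    eigWeight σ i j = σ i / (σ i - σ j) := by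
  unfold eigWeight
  rw [abs_of_pos hi, abs_of_neg hj, if_neg (by linarith), max_eq_left hi.le, max_eq_right hj.le,
    add_zero, sub_eq_add_neg]

theorem eigWeight_of_nonpos_of_neg {ι : Type*} {σ : ι → ℝ} {i j : ι} (hi : σ i ≤ 0)
    (hj : σ j < 0) : eigWeight σ i j = 0 := by
  unfold eigWeight
  rw [abs_of_nonpos hi, abs_of_neg hj, if_neg (by linarith), max_eq_right hi, max_eq_right hj.le]
  simp

/-- The weight is `1` when both eigenvalues are nonnegative, and `0` when one is negative and the
other nonpositive. All blocks thus become a single entrywise product, which avoids later case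
distinctions. -/
theorem blockForm_eq_hadamard {ι : Type*} (σ : ι → ℝ) (M : Matrix ι ι ℝ) :
    blockForm σ M = of (eigWeight σ) ⊙ M := by
  ext i j
  simp only [blockForm, of_apply, hadamard_apply]
  split_ifs with h1 h2
  · rw [eigWeight_of_nonneg h1.1 h1.2, one_mul]
  · rfl
  · rcases lt_or_ge (σ j) 0 with hj | hj
    · rw [eigWeight_of_nonpos_of_neg (not_lt.1 fun hi => h2 (Or.inl ⟨hi, hj⟩)) hj, zero_mul]
    · have hi : σ i < 0 := not_le.1 fun hi => h1 ⟨hi, hj⟩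
      rw [← eigWeight_comm, eigWeight_of_nonpos_of_neg (not_lt.1 fun hj => h2 (Or.inr ⟨hi, hj⟩)) hi,
        zero_mul]

variable {ι : Type*} [Fintype ι]

theorem toMatrix_weightedConj_eigWeight (P : Matrix ι ι ℝ) (σ : ι → ℝ) (D : SymMat ι) :
    (weightedConj P (of (eigWeight σ)) D).toMatrix =
      P * blockForm σ (Pᵀ * D.toMatrix * P) * Pᵀ := by
  rw [blockForm_eq_hadamard]
  exact toMatrix_weightedConj P (fun i j => eigWeight_comm σ i j) D

theorem continuous_metricProj_psdCone : Continuous (metricProj (psdCone ι)) :=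
  continuous_metricProj (E := SymMat ι) psdCone_nonempty isClosed_psdCone convex_psdCone

theorem clarkeJacobian_psdCone_symm_and_norm_sq_le {X : SymMat ι} {W : SymMat ι →L[ℝ] SymMat ι}
    (hW : W ∈ clarkeJacobian (metricProj (psdCone ι)) X) (D E : SymMat ι) :
    inner ℝ (W D) E = inner ℝ D (W E) ∧ ‖W D‖ ^ 2 ≤ inner ℝ (W D) D :=
  clarkeJacobian_metricProj_symm_and_norm_sq_le (E := SymMat ι) psdCone_nonempty isClosed_psdCone
    convex_psdCone hW D E

variable [DecidableEq ι]

/-- The derivative of the complementarity identity. -/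
theorem fderiv_metricProj_psdCone_complementarity {X : SymMat ι}
    (hd : DifferentiableAt ℝ (metricProj (psdCone ι)) X) (D : SymMat ι) :
    (metricProj (psdCone ι) X).toMatrix * (fderiv ℝ (metricProj (psdCone ι)) X D - D).toMatrix +
      (fderiv ℝ (metricProj (psdCone ι)) X D).toMatrix *
        ((metricProj (psdCone ι) X).toMatrix - X.toMatrix) = 0 := by
  set Y := fderiv ℝ (metricProj (psdCone ι)) X D
  have hl : HasDerivAt (fun t : ℝ => metricProj (psdCone ι) (X + t • D)) Y 0 :=
    hd.hasFDerivAt.hasLineDerivAt D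
  have hx : HasDerivAt (fun t : ℝ => X + t • D) D 0 := by
    simpa using ((hasDerivAt_id (0 : ℝ)).smul_const D).const_add X
  have hn := hl.sub hx
  ext i j
  -- Product rule, entry by entry, along the line `X + t • D`; the product itself is constantly
  -- zero.
  have h1 := HasDerivAt.fun_sum (u := Finset.univ) fun k _ =>
    ((entry i k).hasFDerivAt.comp_hasDerivAt (0 : ℝ) hl).mul
      ((entry k j).hasFDerivAt.comp_hasDerivAt (0 : ℝ) hn)
  have h2 : HasDerivAt (fun _ : ℝ => (0 : ℝ)) 0 0 := hasDerivAt_const 0 0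
  have h3 := h1.unique (h2.congr_of_eventuallyEq (Eventually.of_forall fun t => by
    have := congrFun (congrFun (metricProj_psdCone_mul_sub (X + t • D)) i) j
    rw [Matrix.mul_apply] at this
    exact this))
  rw [Matrix.add_apply, Matrix.mul_apply, Matrix.mul_apply, ← Finset.sum_add_distrib]
  simp only [Function.comp_apply, zero_smul, add_zero, entry_apply, Pi.sub_apply] at h3
  rw [Matrix.zero_apply, ← h3]
  refine Finset.sum_congr rfl fun k _ => ?_
  rw [add_comm, ← toMatrix_sub]

/-- With the base point fixed, the identity is affine in `W`, so it passes to convex combinations.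
It passes to limits of derivatives because the projection is continuous. -/
theorem clarkeJacobian_psdCone_complementarity {X : SymMat ι} {W : SymMat ι →L[ℝ] SymMat ι}
    (hW : W ∈ clarkeJacobian (metricProj (psdCone ι)) X) (D : SymMat ι) :
    (metricProj (psdCone ι) X).toMatrix * (W D - D).toMatrix +
      (W D).toMatrix * ((metricProj (psdCone ι) X).toMatrix - X.toMatrix) = 0 := by
  set p := metricProj (psdCone ι)
  let K : Set (SymMat ι →L[ℝ] SymMat ι) := {V | (p X).toMatrix * (V D - D).toMatrix +
      (V D).toMatrix * ((p X).toMatrix - X.toMatrix) = 0}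
  have hK : Convex ℝ K := by
    intro V hV V' hV' a b _ _ hab
    have hV : (p X).toMatrix * (V D - D).toMatrix +
      (V D).toMatrix * ((p X).toMatrix - X.toMatrix) = 0 := hV
    have hV' : (p X).toMatrix * (V' D - D).toMatrix +
      (V' D).toMatrix * ((p X).toMatrix - X.toMatrix) = 0 := hV'
    change (p X).toMatrix * ((a • V + b • V') D - D).toMatrix +
      ((a • V + b • V') D).toMatrix * ((p X).toMatrix - X.toMatrix) = 0
    have e : (a • V + b • V') D - D = a • (V D - D) + b • (V' D - D) := by
      have : D = (a + b) • D := by rw [hab, one_smul]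
      rw [_root_.add_apply, _root_.smul_apply, _root_.smul_apply, smul_sub, smul_sub]
      nth_rw 3 [this]
      rw [add_smul]
      abel
    rw [e, _root_.add_apply, _root_.smul_apply, _root_.smul_apply]
    simp only [toMatrix_add, toMatrix_smul, mul_add, add_mul, Matrix.mul_smul, smul_mul]
    rw [add_add_add_comm, ← smul_add, ← smul_add, hV, hV', smul_zero, smul_zero, add_zero]
  refine convexHull_min ?_ hK hW
  rintro V ⟨xs, hdiff, hxs, hV⟩
  have hv : Tendsto (fun k => fderiv ℝ p (xs k) D) atTop (𝓝 (V D)) :=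
    ((ContinuousLinearMap.apply ℝ (SymMat ι) D).continuous.tendsto V).comp hV
  have hpx : Tendsto (fun k => p (xs k)) atTop (𝓝 (p X)) :=
    (continuous_metricProj_psdCone.tendsto X).comp hxs
  have hc : Continuous fun q : SymMat ι × SymMat ι × SymMat ι =>
      q.1.toMatrix * (q.2.1 - D).toMatrix + q.2.1.toMatrix * (q.1.toMatrix - q.2.2.toMatrix) := by
    have h1 : Continuous fun q : SymMat ι × SymMat ι × SymMat ι => q.1.toMatrix :=
      continuous_toMatrix.comp continuous_fst
    have h2 : Continuous fun q : SymMat ι × SymMat ι × SymMat ι => q.2.1.toMatrix :=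
      continuous_toMatrix.comp (continuous_fst.comp continuous_snd)
    have h3 : Continuous fun q : SymMat ι × SymMat ι × SymMat ι => q.2.2.toMatrix :=
      continuous_toMatrix.comp (continuous_snd.comp continuous_snd)
    simp only [toMatrix_sub]
    exact (h1.matrix_mul (h2.sub continuous_const)).add (h2.matrix_mul (h1.sub h3))
  exact tendsto_nhds_unique ((hc.tendsto (p X, V D, X)).comp
      (hpx.prodMk_nhds (hv.prodMk_nhds hxs)))
    (tendsto_const_nhds.congr fun k =>
      (fderiv_metricProj_psdCone_complementarity (hdiff k) D).symm)

variable {P : Matrix ι ι ℝ} {σ : ι → ℝ} {X : SymMat ι}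

/-- Outside the block of zero eigenvalues, the elements of the generalized Jacobian multiply the
entries by the weights `eigWeight σ`. -/
theorem conj_clarkeJacobian_psdCone_apply (hP : P ∈ orthogonalGroup ι ℝ)
    (hX : X.toMatrix = P * diagonal σ * Pᵀ) {W : SymMat ι →L[ℝ] SymMat ι}
    (hW : W ∈ clarkeJacobian (metricProj (psdCone ι)) X) (D : SymMat ι) {i j : ι}
    (hij : ¬(σ i = 0 ∧ σ j = 0)) :
    (Pᵀ * (W D).toMatrix * P) i j = eigWeight σ i j * (Pᵀ * D.toMatrix * P) i j := by
  have hne : |σ i| + |σ j| ≠ 0 := fun h => hij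
    ⟨abs_eq_zero.1 (by linarith [abs_nonneg (σ i), abs_nonneg (σ j)]),
      abs_eq_zero.1 (by linarith [abs_nonneg (σ i), abs_nonneg (σ j)])⟩
  have h : (diagonal fun i => max (σ i) 0) *
        (Pᵀ * (W D).toMatrix * P - Pᵀ * D.toMatrix * P) +
      (Pᵀ * (W D).toMatrix * P) * ((diagonal fun i => max (σ i) 0) - diagonal σ) + 0 = 0 := by
    rw [← conj_metricProj_psdCone hP hX, ← transpose_mul_mul_of_eq hP hX, ← sub_mul, ← sub_mul,
      ← mul_sub, ← mul_sub, ← toMatrix_sub, ← transpose_mul_mul_mul hP,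
      ← transpose_mul_mul_mul hP, ← add_mul, ← mul_add,
      clarkeJacobian_psdCone_complementarity hW, mul_zero, zero_mul, add_zero]
  have h1 := abs_add_abs_mul_of_complementarity (conj_apply_comm P _) (conj_apply_comm P _) h i j
  rw [← eigWeight_mul_eq hne, Matrix.zero_apply, Matrix.zero_apply, add_zero, sub_zero,
    mul_assoc (|σ i| + |σ j|)] at h1
  exact mul_left_cancel₀ hne h1

/-- The block of zero eigenvalues contributes a nonnegative amount to `⟪W Z, Z - W Z⟫`. -/
theorem sum_zero_block_nonneg (hP : P ∈ orthogonalGroup ι ℝ)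
    (hX : X.toMatrix = P * diagonal σ * Pᵀ) {W : SymMat ι →L[ℝ] SymMat ι}
    (hW : W ∈ clarkeJacobian (metricProj (psdCone ι)) X) (Z : SymMat ι) :
    0 ≤ ∑ i, ∑ j, if σ i = 0 ∧ σ j = 0 then
      (Pᵀ * (W Z).toMatrix * P) i j *
        ((Pᵀ * Z.toMatrix * P) i j - (Pᵀ * (W Z).toMatrix * P) i j) else 0 := by
  have hblock : ∀ D : SymMat ι, ∃ D' : SymMat ι, ∀ i j, (Pᵀ * D'.toMatrix * P) i j =
      if σ i = 0 ∧ σ j = 0 then (Pᵀ * D.toMatrix * P) i j else 0 := by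
    intro D
    obtain ⟨D', hD'⟩ := exists_conj_eq (M := of fun i j =>
      if σ i = 0 ∧ σ j = 0 then (Pᵀ * D.toMatrix * P) i j else 0) hP (by
        ext i j
        simp only [transpose_apply, of_apply, conj_apply_comm P D i j, and_comm])
    exact ⟨D', fun i j => by rw [hD', of_apply]⟩
  -- `Z'` is the zero block of `Z`, and `F` is the zero block of `W (Z - Z')`. Self-adjointness
  -- gives `‖F‖² = ⟪Z - Z', W F⟫`. This is `0`, since `Z - Z'` vanishes on the block and `W F` off
  -- it. So `W Z` and `W Z'` agree on the block.
  obtain ⟨Z', hZ'⟩ := hblock Z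
  obtain ⟨F, hF⟩ := hblock (W (Z - Z'))
  have hF0 : ∑ i, ∑ j, (Pᵀ * F.toMatrix * P) i j ^ 2 = 0 := by
    calc _ = inner ℝ (W (Z - Z')) F := by
          rw [inner_eq_sum_conj hP]
          refine Finset.sum_congr rfl fun i _ => Finset.sum_congr rfl fun j _ => ?_
          rw [hF]
          split_ifs <;> ring
      _ = inner ℝ (Z - Z') (W F) := (clarkeJacobian_psdCone_symm_and_norm_sq_le hW _ _).1
      _ = 0 := by
          rw [inner_eq_sum_conj hP]
          refine Finset.sum_eq_zero fun i _ => Finset.sum_eq_zero fun j _ => ?_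
          by_cases h : σ i = 0 ∧ σ j = 0
          · rw [toMatrix_sub, mul_sub, sub_mul, Matrix.sub_apply, hZ', if_pos h, sub_self, zero_mul]
          · rw [conj_clarkeJacobian_psdCone_apply hP hX hW F h, hF, if_neg h, mul_zero, mul_zero]
  have hF1 : ∀ i j, (Pᵀ * F.toMatrix * P) i j = 0 := by
    intro i j
    have h1 := (Finset.sum_eq_zero_iff_of_nonneg fun i _ =>
      Finset.sum_nonneg fun j _ => sq_nonneg _).1 hF0 i (Finset.mem_univ _)
    have h2 := (Finset.sum_eq_zero_iff_of_nonneg fun j _ => sq_nonneg _).1 h1 j (Finset.mem_univ _)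
    exact pow_eq_zero_iff two_ne_zero |>.1 h2
  -- Firm nonexpansiveness is applied to `Z'`, whose pairing has no terms outside the zero block.
  have hpos : 0 ≤ inner ℝ (W Z') (Z' - W Z') := by
    rw [inner_sub_right, real_inner_self_eq_norm_sq]
    exact sub_nonneg.2 (clarkeJacobian_psdCone_symm_and_norm_sq_le hW Z' Z').2
  rw [inner_eq_sum_conj hP] at hpos
  refine hpos.trans_eq (Finset.sum_congr rfl fun i _ => Finset.sum_congr rfl fun j _ => ?_)
  rw [toMatrix_sub, mul_sub, sub_mul, Matrix.sub_apply]
  split_ifs with h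
  · have h1 := hF i j
    rw [if_pos h, hF1, map_sub, toMatrix_sub, mul_sub, sub_mul, Matrix.sub_apply] at h1
    rw [hZ', if_pos h, sub_eq_zero.1 h1.symm]
  · rw [conj_clarkeJacobian_psdCone_apply hP hX hW Z' h, hZ', if_neg h]
    ring

theorem conj_weightedConj_apply (hP : P ∈ orthogonalGroup ι ℝ) (σ : ι → ℝ) (D : SymMat ι)
    (i j : ι) : (Pᵀ * (weightedConj P (of (eigWeight σ)) D).toMatrix * P) i j =
      eigWeight σ i j * (Pᵀ * D.toMatrix * P) i j := by
  rw [transpose_mul_mul_of_eq hP (toMatrix_weightedConj_eigWeight P σ D), blockForm_eq_hadamard]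
  rfl

theorem weightedConj_mem_clarkeJacobian (hP : P ∈ orthogonalGroup ι ℝ)
    (hX : X.toMatrix = P * diagonal σ * Pᵀ) :
    weightedConj P (of (eigWeight σ)) ∈ clarkeJacobian (metricProj (psdCone ι)) X :=
  subset_convexHull ℝ _ (weightedConj_mem_limitingJacobian hP hX)

/-- Every element of the range of the generalized Jacobian is attained by the extremal element of
the limiting Jacobian, at a point that minimizes the pairing. -/
theorem exists_isLeast_jacobianPairings_psdCone (hP : P ∈ orthogonalGroup ι ℝ)
    (hX : X.toMatrix = P * diagonal σ * Pᵀ) {Y : SymMat ι}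
    (hY : Y ∈ jacobianRange (metricProj (psdCone ι)) X) :
    ∃ D : SymMat ι,
      (∀ i j, (Pᵀ * D.toMatrix * P) i j = (Pᵀ * Y.toMatrix * P) i j / eigWeight σ i j) ∧
      Y = weightedConj P (of (eigWeight σ)) D ∧
      IsLeast (jacobianPairings (metricProj (psdCone ι)) X Y) (inner ℝ Y (D - Y)) := by
  -- `Wbar` is inverted by dividing by the weights. Where a weight is `0`, division yields `0`; this
  -- is consistent because `Y` vanishes there, by `hvanish`.
  obtain ⟨D, hD⟩ := exists_conj_eq (M := of fun i j =>
    (Pᵀ * Y.toMatrix * P) i j / eigWeight σ i j) hP (by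
      ext i j
      simp only [transpose_apply, of_apply, conj_apply_comm P Y i j, eigWeight_comm σ i j])
  have hD' : ∀ i j, (Pᵀ * D.toMatrix * P) i j =
      (Pᵀ * Y.toMatrix * P) i j / eigWeight σ i j := fun i j => by rw [hD, of_apply]
  have hvanish : ∀ W ∈ clarkeJacobian (metricProj (psdCone ι)) X, ∀ Z, Y = W Z → ∀ i j,
      eigWeight σ i j = 0 → (Pᵀ * Y.toMatrix * P) i j = 0 := by
    intro W hW Z hYZ i j h0
    have h : ¬(σ i = 0 ∧ σ j = 0) := fun h => by
      rw [eigWeight_of_nonneg h.1.ge h.2.ge] at h0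
      exact one_ne_zero h0
    rw [hYZ, conj_clarkeJacobian_psdCone_apply hP hX hW Z h, h0, zero_mul]
  have hYD : Y = weightedConj P (of (eigWeight σ)) D := by
    simp only [jacobianRange, Set.mem_iUnion, Set.mem_range, exists_prop] at hY
    obtain ⟨W, hW, Z, hYZ⟩ := hY
    apply toMatrix_injective
    rw [eq_mul_mul_transpose_of_eq hP (N := Y.toMatrix) rfl,
      eq_mul_mul_transpose_of_eq hP (N := (weightedConj P (of (eigWeight σ)) D).toMatrix) rfl]
    congr 2
    ext i j
    rw [conj_weightedConj_apply hP, hD']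
    by_cases h0 : eigWeight σ i j = 0
    · rw [hvanish W hW Z hYZ.symm i j h0, h0, zero_mul]
    · rw [mul_div_cancel₀ _ h0]
  refine ⟨D, hD', hYD, ⟨_, weightedConj_mem_clarkeJacobian hP hX, D, hYD, rfl⟩, ?_⟩
  rintro t ⟨W, hW, Z, hYZ, rfl⟩
  have hb := sum_zero_block_nonneg hP hX hW Z
  rw [← hYZ] at hb
  -- Term by term, the difference of the two pairings is the zero-block sum of `hb`. Off the block
  -- either `Y` vanishes or `Z` has the same entry as `D`; on the block `D = Y`.
  rw [← sub_nonneg, inner_eq_sum_conj hP, inner_eq_sum_conj hP, ← Finset.sum_sub_distrib]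
  refine hb.trans_eq (Finset.sum_congr rfl fun i _ => ?_)
  rw [← Finset.sum_sub_distrib]
  refine Finset.sum_congr rfl fun j _ => ?_
  simp only [toMatrix_sub, mul_sub, sub_mul, Matrix.sub_apply, hD']
  split_ifs with h
  · rw [eigWeight_of_nonneg h.1.ge h.2.ge]
    ring
  · by_cases h0 : eigWeight σ i j = 0
    · rw [hvanish W hW Z hYZ i j h0]
      ring
    · have := conj_clarkeJacobian_psdCone_apply hP hX hW Z h
      rw [← hYZ] at this
      rw [this]
      field_simp
      ring

theorem jacobianRange_psdCone (hP : P ∈ orthogonalGroup ι ℝ)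
    (hX : X.toMatrix = P * diagonal σ * Pᵀ) :
    jacobianRange (metricProj (psdCone ι)) X =
      Set.range (weightedConj P (of (eigWeight σ))) := by
  refine Set.Subset.antisymm (fun Y hY => ?_) ?_
  · obtain ⟨D, -, h, -⟩ := exists_isLeast_jacobianPairings_psdCone hP hX hY
    exact ⟨D, h.symm⟩
  · exact Set.subset_biUnion_of_mem (u := fun W : SymMat ι →L[ℝ] SymMat ι => Set.range W)
      (weightedConj_mem_clarkeJacobian hP hX)

/-- Only the `αγ` and `γα` blocks contribute: a weight `1` gives `D - Y = 0` there, and a weight `0`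
forces `Y = 0`. For `i ∈ α`, `j ∈ γ` the inverse weight minus one is `(σᵢ - σⱼ) / σᵢ - 1 = -σⱼ /
σᵢ`. The two transposed blocks account for the factor `2`. -/
theorem inner_weightedConj_sub (hP : P ∈ orthogonalGroup ι ℝ) {Y D : SymMat ι}
    (hD : ∀ i j, (Pᵀ * D.toMatrix * P) i j = (Pᵀ * Y.toMatrix * P) i j / eigWeight σ i j)
    (hYD : Y = weightedConj P (of (eigWeight σ)) D) :
    inner ℝ Y (D - Y) = -2 * ∑ i with 0 < σ i, ∑ j with σ j < 0,
      σ j / σ i * (Pᵀ * Y.toMatrix * P) i j ^ 2 := by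
  set M := Pᵀ * Y.toMatrix * P with hM
  have hMs : ∀ i j, M j i = M i j := conj_apply_comm P Y
  have hM0 : ∀ i j, eigWeight σ i j = 0 → M i j = 0 := fun i j h => by
    rw [hM, hYD, conj_weightedConj_apply hP, h, zero_mul]
  let f : ι → ι → ℝ := fun i j => if 0 < σ i ∧ σ j < 0 then σ j / σ i * M i j ^ 2 else 0
  have hf : ∑ i with 0 < σ i, ∑ j with σ j < 0, σ j / σ i * M i j ^ 2 = ∑ i, ∑ j, f i j := by
    simp only [Finset.sum_filter, f, ite_and]
    refine Finset.sum_congr rfl fun i _ => ?_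
    split_ifs <;> simp
  have hpn : ∀ i j, 0 < σ i → σ j < 0 →
      M i j * (M i j / eigWeight σ i j - M i j) = -(σ j / σ i * M i j ^ 2) := by
    intro i j hi hj
    have : σ i - σ j ≠ 0 := by linarith
    rw [eigWeight_of_pos_of_neg hi hj]
    field_simp
    ring
  have hterm : ∀ i j, M i j * (M i j / eigWeight σ i j - M i j) = -f i j - f j i := by
    intro i j
    simp only [f]
    rcases lt_or_ge (σ j) 0 with hj | hj
    · rw [if_neg (c := 0 < σ j ∧ _) fun h => h.1.not_gt hj, sub_zero]
      rcases lt_or_ge 0 (σ i) with hi | hi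
      · rw [if_pos ⟨hi, hj⟩, hpn i j hi hj]
      · rw [if_neg fun h => h.1.not_ge hi, hM0 i j (eigWeight_of_nonpos_of_neg hi hj)]
        simp
    · rw [if_neg (c := 0 < σ i ∧ _) fun h => h.2.not_ge hj, neg_zero, zero_sub]
      rcases lt_or_ge (σ i) 0 with hi | hi
      · rw [← hMs i j, ← eigWeight_comm]
        rcases hj.lt_or_eq with hj | hj
        · rw [if_pos ⟨hj, hi⟩, hpn j i hj hi]
        · rw [if_neg fun h => h.1.ne hj, hM0 j i (eigWeight_of_nonpos_of_neg hj.ge hi)]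
          simp
      · rw [if_neg fun h => h.2.not_ge hi, eigWeight_of_nonneg hi hj]
        ring
  rw [inner_eq_sum_conj hP, hf]
  simp only [toMatrix_sub, mul_sub, sub_mul, Matrix.sub_apply, hD]
  simp only [← mul_sub, ← hM, hterm]
  simp only [Finset.sum_sub_distrib, Finset.sum_neg_distrib]
  rw [Finset.sum_comm (f := fun i j => f j i)]
  ring

/-- At the zero matrix every weight is the default value `0 / 0 := 1`, so the weighted map is the
identity. -/
theorem id_mem_limitingJacobian_metricProj_psdCone :
    ContinuousLinearMap.id ℝ (SymMat ι) ∈ limitingJacobian (metricProj (psdCone ι)) 0 := by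
  have h := weightedConj_mem_limitingJacobian (ι := ι) (P := 1) (σ := 0) (X := 0)
    (one_mem _) (by simp)
  convert h using 1
  ext1 D
  apply toMatrix_injective
  rw [toMatrix_weightedConj_eigWeight, blockForm_eq_hadamard]
  ext i j
  simp [eigWeight]

theorem jacobianRangeCondition_psdCone {U : SymMat ι} (hX : X ∈ psdCone ι)
    (hU : U ∈ limitingNormalCone (psdCone ι) X) :
    JacobianRangeCondition (indicatorFun (psdCone ι)) X U := by
  obtain ⟨P, hP, σ, hXU⟩ := (X + U).exists_diagonalization
  rw [JacobianRangeCondition, proxMap_indicatorFun psdCone_nonempty, effDomain_indicatorFun,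
    epigraph_indicatorFun]
  refine ⟨lowerSemicontinuous_indicatorFun isClosed_psdCone,
    isProperFun_indicatorFun psdCone_nonempty, convex_psdCone.prod (convex_Ici 0), hX,
    limitingNormalCone_subset_limitingSubdifferential X hU, _,
    weightedConj_mem_limitingJacobian hP hXU, jacobianRange_psdCone hP hXU, fun Y hY => ?_⟩
  obtain ⟨D, -, h1, h2⟩ := exists_isLeast_jacobianPairings_psdCone hP hXU hY
  exact ⟨D, h1, h2⟩

end PsdProjectionJacobian

end

/-! ### The range condition and the explicit formulas for an arbitrary diagonalization of `X + U`.
-/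

theorem mainTheorem5 (m : ℕ) (X U : SymMat (Fin m))
    (hX : X ∈ psdCone (Fin m)) (hU : U ∈ limitingNormalCone (psdCone (Fin m)) X) :
    JacobianRangeCondition (indicatorFun (psdCone (Fin m))) X U ∧
    ∀ (P : Matrix (Fin m) (Fin m) ℝ) (σ : Fin m → ℝ),
      P ∈ Matrix.orthogonalGroup (Fin m) ℝ →
      X.toMatrix + U.toMatrix = P * Matrix.diagonal σ * Pᵀ →
      -- the identity is an admissible choice of `Z` on the block of zero eigenvalues
      ContinuousLinearMap.id ℝ (SymMat {i : Fin m // σ i = 0}) ∈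
        limitingJacobian (metricProj (psdCone {i : Fin m // σ i = 0})) 0 ∧
      ∃ Wbar ∈ limitingJacobian (metricProj (psdCone (Fin m))) (X + U),
        (∀ D : SymMat (Fin m),
          (Wbar D).toMatrix = P * blockForm σ (Pᵀ * D.toMatrix * P) * Pᵀ) ∧
        {Y : SymMat (Fin m) | ∃ D : SymMat (Fin m),
            Y.toMatrix = P * blockForm σ (Pᵀ * D.toMatrix * P) * Pᵀ} =
          jacobianRange (metricProj (psdCone (Fin m))) (X + U) ∧
        jacobianRange (metricProj (psdCone (Fin m))) (X + U) = Set.range Wbar ∧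
        ∀ Y ∈ jacobianRange (metricProj (psdCone (Fin m))) (X + U),
          ∃ Dbar : SymMat (Fin m),
            (∀ i j, 0 ≤ σ i → 0 ≤ σ j →
              (Pᵀ * Dbar.toMatrix * P) i j = (Pᵀ * Y.toMatrix * P) i j) ∧
            (∀ i j, 0 < σ i → σ j < 0 →
              (Pᵀ * Dbar.toMatrix * P) i j =
                (σ i - σ j) / σ i * (Pᵀ * Y.toMatrix * P) i j ∧
              (Pᵀ * Dbar.toMatrix * P) j i =
                (σ i - σ j) / σ i * (Pᵀ * Y.toMatrix * P) i j) ∧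
            Y = Wbar Dbar ∧
            IsLeast (jacobianPairings (metricProj (psdCone (Fin m))) (X + U) Y)
              (inner ℝ Y (Dbar - Y)) ∧
            inner ℝ Y (Dbar - Y) =
              -2 * ∑ i with 0 < σ i, ∑ j with σ j < 0,
                σ j / σ i * (Pᵀ * Y.toMatrix * P) i j ^ 2 := by
  
  refine ⟨jacobianRangeCondition_psdCone hX hU, fun P σ hP hXU => ?_⟩
  rw [← SymMat.toMatrix_add] at hXU
  refine ⟨id_mem_limitingJacobian_metricProj_psdCone, _, weightedConj_mem_limitingJacobian hP hXU,
    ?_, ?_, jacobianRange_psdCone hP hXU, fun Y hY => ?_⟩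
  · exact toMatrix_weightedConj_eigWeight P σ
  · rw [jacobianRange_psdCone hP hXU]
    ext Y
    refine exists_congr fun D => ?_
    rw [← toMatrix_weightedConj_eigWeight, SymMat.toMatrix_injective.eq_iff, eq_comm]
  · obtain ⟨D, hD, hYD, hleast⟩ := exists_isLeast_jacobianPairings_psdCone hP hXU hY
    refine ⟨D, fun i j hi hj => ?_, fun i j hi hj => ?_, hYD, hleast,
      inner_weightedConj_sub hP hD hYD⟩
    · rw [hD, eigWeight_of_nonneg hi hj, div_one]
    · rw [hD j i, eigWeight_comm, SymMat.conj_apply_comm P Y i j, hD i j,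
        eigWeight_of_pos_of_neg hi hj, div_div_eq_mul_div]
      constructor <;> ring
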